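/- For a group $G$ let $\mathbb ZG$ be its integral group ring, $\Delta(G)$ the augmentation ideal of $\mathbb ZG$, and $\mathcal V(\mathbb ZG)$ the group of units of $\mathbb ZG$ of augmentation one. Put $\mathcal V_n(\mathbb ZG)=\mathcal V(\mathbb ZG)\cap(1+\Delta^n(G))$ for $n\ge 1$ and $\mathcal V_\omega(\mathbb ZG)=\bigcap_{n\ge 1}\mathcal V_n(\mathbb ZG)$. For a prime $p$, an element $h$ of a group $H$ has infinite $p$-height in $H$ if for all natural numbers $i,j$ there are $x\in H$ and $y\in\gamma_j(H)$ (the $j$-th term of the lower central series, $\gamma_1(H)=H$) with $x^{p^i}=hy$. The elements of infinite $p$-height in $H$ form a subgroup, denoted $H(p)$. Theorem. Let $G$ be a nilpotent group with $\mathcal V_\omega(\mathbb ZG)=\{1\}$, and let $T$ be its torsion subgroup. Then at least one of the following holds: (i) $T=\{1\}$; (ii) the order of every element of $T$ is of the form $2^a3^b$, and $T$ has exponent (exactly) $6$; (iii) for some prime $p$, $T$ is a $p$-group, $T(p)\neq T$, and $T(p)$ is an abelian $p$-group of exponent at most $4$. In particular, if moreover $T$ has no element of order $2$ or $3$, then either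 $G$ is torsion-free, or for some prime $p$ the group $T$ is a $p$-group in which no element other than $1$ has infinite $p$-height in $T$. -/

import Mathlib

namespace GroupRingUnits

open Subgroup
open scoped commutatorElement

/-! ### The filtration of the normalized unit group of the integral group ring -/

/-- The augmentation map of the integral group ring `ℤG`, sending every `g ∈ G` to `1`. -/
noncomputable def augmentation (G : Type*) [Group G] : MonoidAlgebra ℤ G →ₐ[ℤ] ℤ :=
  MonoidAlgebra.lift ℤ ℤ G 1

/-- The augmentation ideal `Δ(G)` of `ℤG`. -/
noncomputable def augmentationIdeal (G : Type*) [Group G] : Ideal (MonoidAlgebra ℤ G) :=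
  RingHom.ker (augmentation G)

/-- The group `𝒱(ℤG)` of normalized units: the units of `ℤG` of augmentation one. -/
noncomputable def normalizedUnits (G : Type*) [Group G] : Subgroup (MonoidAlgebra ℤ G)ˣ :=
  (Units.map (augmentation G : MonoidAlgebra ℤ G →* ℤ)).ker

/-- `𝒱_n(ℤG) = 𝒱(ℤG) ∩ (1 + Δⁿ(G))`. -/
noncomputable def unitFiltration (G : Type*) [Group G] (n : ℕ) :
    Subgroup (MonoidAlgebra ℤ G)ˣ where
  carrier := {u | u ∈ normalizedUnits G ∧ (u : MonoidAlgebra ℤ G) - 1 ∈ augmentationIdeal G ^ n}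
  one_mem' := ⟨one_mem _, by simp⟩
  mul_mem' := by
    rintro u v ⟨hu, hu'⟩ ⟨hv, hv'⟩
    refine ⟨mul_mem hu hv, ?_⟩
    have h : ((u * v : (MonoidAlgebra ℤ G)ˣ) : MonoidAlgebra ℤ G) - 1
        = (u : MonoidAlgebra ℤ G) * ((v : MonoidAlgebra ℤ G) - 1) + (u - 1) := by
      push_cast; noncomm_ring
    rw [h]
    exact add_mem (Ideal.mul_mem_left _ _ hv') hu'
  inv_mem' := by
    rintro u ⟨hu, hu'⟩
    refine ⟨inv_mem hu, ?_⟩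
    have h : ((u⁻¹ : (MonoidAlgebra ℤ G)ˣ) : MonoidAlgebra ℤ G) - 1
        = -((u⁻¹ : (MonoidAlgebra ℤ G)ˣ) : MonoidAlgebra ℤ G) * ((u : MonoidAlgebra ℤ G) - 1) := by
      rw [mul_sub, neg_mul, Units.inv_mul]; noncomm_ring
    rw [h]
    exact Ideal.mul_mem_left _ _ hu'

/-- The `Δ`-adic residue `𝒱_ω(ℤG) = ⋂_{n ≥ 1} 𝒱_n(ℤG)`. -/
noncomputable def deltaAdicResidue (G : Type*) [Group G] : Subgroup (MonoidAlgebra ℤ G)ˣ :=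
  ⨅ n : ℕ, ⨅ _ : 1 ≤ n, unitFiltration G n

/-! ### Facts on nilpotent groups: the torsion elements, and the elements of infinite `p`-height,
form subgroups -/

/-- In a nilpotent group of class at most `c + 2`, the subgroup generated by one element and the
commutator subgroup has class at most `c + 1`. -/
theorem lcs_zpowers_sup_commutator {Q : Type*} [Group Q] (g : Q) (n : ℕ) :
    (zpowers g ⊔ commutator Q).lowerCentralSeries (n + 1)
      ≤ (⊤ : Subgroup Q).lowerCentralSeries (n + 2) := by
  induction n with
  | zero =>
    set L := (⊤ : Subgroup Q).lowerCentralSeries 2 with hL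
    let π := QuotientGroup.mk' L
    have hcomm : ∀ a b : Q, ⁅a, b⁆ ∈ L ↔ π a * π b = π b * π a := by
      intro a b
      rw [← commutatorElement_eq_one_iff_mul_comm, ← map_commutatorElement]
      exact (QuotientGroup.eq_one_iff _).symm
    have hC : ∀ h : Q, commutator Q ≤ (centralizer {π h}).comap π := by
      intro h u hu
      rw [mem_comap, mem_centralizer_singleton_iff, ← hcomm]
      exact commutator_mem_commutator (show u ∈ (⊤ : Subgroup Q).lowerCentralSeries 1 from hu)
        (mem_top h)
    have h1 : zpowers g ⊔ commutator Q ≤ (centralizer {π g}).comap π := by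
      refine sup_le ?_ (hC g)
      rw [zpowers_le, mem_comap, mem_centralizer_singleton_iff]
    refine commutator_le.2 fun h hh k hk => ?_
    have h2 : zpowers g ⊔ commutator Q ≤ (centralizer {π h}).comap π := by
      refine sup_le ?_ (hC h)
      have := h1 hh
      rw [mem_comap, mem_centralizer_singleton_iff] at this
      rw [zpowers_le, mem_comap, mem_centralizer_singleton_iff]
      exact this.symm
    have := h2 hk
    rw [mem_comap, mem_centralizer_singleton_iff] at this
    exact (hcomm h k).2 this.symm
  | succ n ih => exact commutator_mono ih le_top

theorem lcs_zpowers_sup_commutator_eq_bot {Q : Type*} [Group Q] (g : Q) (c : ℕ)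
    (h : (⊤ : Subgroup Q).lowerCentralSeries (c + 2) = ⊥) :
    (⊤ : Subgroup ↥(zpowers g ⊔ commutator Q)).lowerCentralSeries (c + 1) = ⊥ := by
  have h1 := (lcs_zpowers_sup_commutator g c).trans h.le
  rw [← top_subtype_lowerCentralSeries, le_bot_iff] at h1
  exact (map_eq_bot_iff_of_injective _ (subtype_injective _)).1 h1

theorem mul_comm_of_lcs_one {Q : Type*} [Group Q]
    (h : (⊤ : Subgroup Q).lowerCentralSeries 1 = ⊥) (x y : Q) : x * y = y * x := by
  have : ⁅x, y⁆ ∈ (⊤ : Subgroup Q).lowerCentralSeries 1 :=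
    commutator_mem_commutator (mem_top x) (mem_top y)
  rw [h, mem_bot] at this
  exact commutatorElement_eq_one_iff_mul_comm.1 this

/-- In a nilpotent group the product of two elements of finite order has finite order. -/
theorem isOfFinOrder_mul_of_lcs (c : ℕ) : ∀ (Q : Type*) [Group Q],
    (⊤ : Subgroup Q).lowerCentralSeries c = ⊥ →
    ∀ x y : Q, IsOfFinOrder x → IsOfFinOrder y → IsOfFinOrder (x * y) := by
  induction c using Nat.strong_induction_on with
  | _ c ih =>
    intro Q _ hc x y hx hy
    match c, ih, hc with
    | 0, _, hc =>
      have : x * y ∈ (⊤ : Subgroup Q) := mem_top _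
      rw [← Subgroup.lowerCentralSeries_zero (⊤ : Subgroup Q), hc, mem_bot] at this
      rw [this]; exact IsOfFinOrder.one
    | 1, _, hc => exact (show Commute x y from mul_comm_of_lcs_one hc x y).isOfFinOrder_mul hx hy
    | c + 2, ih, hc =>
      let H := zpowers y ⊔ commutator Q
      have hH := lcs_zpowers_sup_commutator_eq_bot y c hc
      have hmul : ∀ a b : Q, a ∈ H → b ∈ H → IsOfFinOrder a → IsOfFinOrder b →
          IsOfFinOrder (a * b) := by
        intro a b ha hb ha' hb'
        have := ih (c + 1) (by omega) H hH ⟨a, ha⟩ ⟨b, hb⟩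
          (Submonoid.isOfFinOrder_coe.1 ha') (Submonoid.isOfFinOrder_coe.1 hb')
        exact Submonoid.isOfFinOrder_coe.2 this
      have hyH : y ∈ H := mem_sup_left (mem_zpowers y)
      have hconj : ∀ a g : Q, a ∈ H → g⁻¹ * a * g ∈ H := by
        intro a g ha
        have h1 : a * ⁅a⁻¹, g⁻¹⁆ = g⁻¹ * a * g := by
          rw [commutatorElement_def]; group
        rw [← h1]
        exact mul_mem ha (mem_sup_right (commutator_mem_commutator (mem_top _) (mem_top _)))
      have hpow : ∀ k : ℕ, ∃ b ∈ H, IsOfFinOrder b ∧ (x * y) ^ k = x ^ k * b := by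
        intro k
        induction k with
        | zero => exact ⟨1, one_mem _, IsOfFinOrder.one, by simp⟩
        | succ k ihk =>
          obtain ⟨b, hb, hb', hk⟩ := ihk
          have hfin : IsOfFinOrder (x⁻¹ * b * x) := by
            have := (MulAut.conj x⁻¹).toMonoidHom.isOfFinOrder hb'
            simpa using this
          refine ⟨x⁻¹ * b * x * y, mul_mem (hconj b x hb) hyH,
            hmul _ _ (hconj b x hb) hyH hfin hy, ?_⟩
          rw [pow_succ, hk, pow_succ]; group
      obtain ⟨n, hn, hxn⟩ := isOfFinOrder_iff_pow_eq_one.1 hx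
      obtain ⟨b, -, hb', hk⟩ := hpow n
      rw [hxn, one_mul] at hk
      rw [← hk] at hb'
      exact hb'.of_pow hn.ne'

/-- If the commutator subgroup of a group of class at most `c` has exponent dividing `M`, then
`M ^ (2 * c)`-th powers are central and multiplicative. -/
theorem pow_mul_of_commutator_exponent (M c : ℕ) : ∀ (K : Type*) [Group K],
    (⊤ : Subgroup K).lowerCentralSeries c = ⊥ → (∀ u ∈ commutator K, u ^ M = 1) →
    ∀ x y : K, x ^ M ^ (2 * c) * y = y * x ^ M ^ (2 * c) ∧
      (x * y) ^ M ^ (2 * c) = x ^ M ^ (2 * c) * y ^ M ^ (2 * c) := by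
  induction c with
  | zero =>
    intro K _ h _ x y
    have h1 : ∀ g : K, g = 1 := by
      intro g
      have : g ∈ (⊤ : Subgroup K) := mem_top _
      rwa [← Subgroup.lowerCentralSeries_zero (⊤ : Subgroup K), h, mem_bot] at this
    rw [h1 x, h1 y]; simp
  | succ c ih =>
    intro K _ h hM
    let π := QuotientGroup.mk' (center K)
    have hπ : Function.Surjective π := QuotientGroup.mk'_surjective _
    have hQ : (⊤ : Subgroup (K ⧸ center K)).lowerCentralSeries c = ⊥ := by
      rw [← map_top_of_surjective π hπ, ← map_lowerCentralSeries, eq_bot_iff, map_le_iff_le_comap]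
      intro z hz
      rw [mem_comap, mem_bot]
      refine (QuotientGroup.eq_one_iff z).2 (mem_center_iff.2 fun g => ?_)
      have : ⁅z, g⁆ ∈ (⊤ : Subgroup K).lowerCentralSeries (c + 1) :=
        commutator_mem_commutator hz (mem_top g)
      rw [h, mem_bot] at this
      exact (commutatorElement_eq_one_iff_mul_comm.1 this).symm
    have hMQ : ∀ u ∈ commutator (K ⧸ center K), u ^ M = 1 := by
      intro u hu
      rw [_root_.commutator_def, ← map_top_of_surjective π hπ, ← map_commutator] at hu
      obtain ⟨v, hv, rfl⟩ := hu
      rw [← map_pow, hM v hv, map_one]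
    have IH := ih _ hQ hMQ
    set N := M ^ (2 * c) with hN
    have hcomm : ∀ x g : K, ⁅x, g⁆ ∈ commutator K := fun x g =>
      commutator_mem_commutator (mem_top x) (mem_top g)
    have hcen : ∀ x g : K, x ^ (N * M) * g = g * x ^ (N * M) := by
      intro x g
      have hz : ⁅g, x ^ N⁆ ∈ center K := by
        refine (QuotientGroup.eq_one_iff _).1 ?_
        change π _ = 1
        rw [map_commutatorElement, commutatorElement_eq_one_iff_mul_comm, map_pow]
        exact ((IH (π x) (π g)).1).symm
      have h1 : (g * x ^ N * g⁻¹) ^ M = x ^ (N * M) := by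
        have : g * x ^ N * g⁻¹ = ⁅g, x ^ N⁆ * x ^ N := by rw [commutatorElement_def]; group
        rw [this, ((show Commute (x ^ N) ⁅g, x ^ N⁆ from mem_center_iff.1 hz _).symm).mul_pow,
          hM _ (hcomm _ _), one_mul, pow_mul]
      rw [conj_pow, ← pow_mul, mul_inv_eq_iff_eq_mul] at h1
      exact h1.symm
    have hpow : N * M * M = M ^ (2 * (c + 1)) := by rw [hN]; ring
    intro x y
    rw [← hpow]
    refine ⟨?_, ?_⟩
    · rw [pow_mul]
      exact (show Commute (x ^ (N * M)) y from hcen x y).pow_left M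
    · set ζ := (x ^ (N * M) * y ^ (N * M))⁻¹ * (x * y) ^ (N * M) with hζ
      have e1 : π ((x * y) ^ (N * M)) = π (x ^ (N * M) * y ^ (N * M)) := by
        rw [map_pow, map_mul, map_mul, map_pow, map_pow, pow_mul, (IH (π x) (π y)).2,
          (show Commute (π x ^ N) (π y ^ N) from (IH (π x) (π y ^ N)).1).mul_pow, ← pow_mul,
          ← pow_mul]
      have hz : ζ ∈ center K := by
        refine (QuotientGroup.eq_one_iff _).1 ?_
        change π _ = 1
        rw [hζ, map_mul, map_inv, e1, inv_mul_cancel]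
      have hz' : ζ ∈ commutator K := by
        refine (Abelianization.ker_of K) ▸ ?_
        rw [MonoidHom.mem_ker, hζ]
        simp only [map_mul, map_inv, map_pow, mul_pow, inv_mul_cancel]
      have e2 : (x * y) ^ (N * M) = x ^ (N * M) * y ^ (N * M) * ζ := by rw [hζ]; group
      rw [pow_mul, e2, (show Commute (x ^ (N * M) * y ^ (N * M)) ζ from
        mem_center_iff.1 hz _).mul_pow, hM ζ hz', mul_one,
        (show Commute (x ^ (N * M)) (y ^ (N * M)) from hcen x _).mul_pow, ← pow_mul, ← pow_mul]

/-- In groups of class at most `c` a product of `m ^ e`-th powers is an `m`-th power, for a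
suitable `e` that depends only on `c`. -/
theorem exists_pow_of_mem_closure_pow (c : ℕ) : ∃ e : ℕ, ∀ (Q : Type*) [Group Q] (m : ℕ),
    (⊤ : Subgroup Q).lowerCentralSeries c = ⊥ →
    ∀ w ∈ closure (Set.range fun g : Q => g ^ m ^ e), ∃ z : Q, w = z ^ m := by
  induction c using Nat.strong_induction_on with
  | _ c ih =>
    match c, ih with
    | 0, _ =>
      refine ⟨1, fun Q _ m hc w _ => ⟨1, ?_⟩⟩
      have : w ∈ (⊤ : Subgroup Q) := mem_top _
      rw [← Subgroup.lowerCentralSeries_zero (⊤ : Subgroup Q), hc, mem_bot] at this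
      simpa using this
    | 1, _ =>
      refine ⟨1, fun Q _ m hc w hw => ?_⟩
      induction hw using closure_induction with
      | mem w hw => obtain ⟨g, rfl⟩ := hw; exact ⟨g, by simp⟩
      | one => exact ⟨1, by simp⟩
      | mul a b _ _ ha hb =>
        obtain ⟨x, rfl⟩ := ha
        obtain ⟨y, rfl⟩ := hb
        exact ⟨x * y, ((show Commute x y from mul_comm_of_lcs_one hc x y).mul_pow m).symm⟩
      | inv a _ ha => obtain ⟨x, rfl⟩ := ha; exact ⟨x⁻¹, by simp⟩
    | c + 2, ih =>
      obtain ⟨e, he⟩ := ih (c + 1) (by omega)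
      refine ⟨e * (2 * (c + 2)), fun Q _ m hc w hw => ?_⟩
      set M := m ^ e with hMdef
      rw [pow_mul] at hw
      set N := M ^ (2 * (c + 2)) with hN
      let S : Set Q := {v | ∃ u ∈ commutator Q, v = u ^ M}
      let R : Subgroup Q := normalClosure S
      have hRS : R = closure S := by
        refine le_antisymm ?_ closure_le_normalClosure
        have : (closure S).Normal := by
          refine ⟨fun n hn g => ?_⟩
          have : (closure S).map (MulAut.conj g).toMonoidHom ≤ closure S := by
            rw [MonoidHom.map_closure, closure_le]
            rintro _ ⟨_, ⟨u, hu, rfl⟩, rfl⟩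
            refine subset_closure ⟨g * u * g⁻¹, ?_, by simp⟩
            exact (inferInstance : (commutator Q).Normal).conj_mem u hu g
          simpa using this (mem_map_of_mem _ hn)
        exact normalClosure_le_normal subset_closure
      let π := QuotientGroup.mk' R
      have hπ : Function.Surjective π := QuotientGroup.mk'_surjective _
      have hK : (⊤ : Subgroup (Q ⧸ R)).lowerCentralSeries (c + 2) = ⊥ := by
        rw [← map_top_of_surjective π hπ, ← map_lowerCentralSeries, hc, Subgroup.map_bot]
      have hMK : ∀ u ∈ commutator (Q ⧸ R), u ^ M = 1 := by
        intro u hu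
        rw [_root_.commutator_def, ← map_top_of_surjective π hπ, ← map_commutator] at hu
        obtain ⟨v, hv, rfl⟩ := hu
        rw [← map_pow]
        exact (QuotientGroup.eq_one_iff _).2 (subset_normalClosure ⟨v, hv, rfl⟩)
      have hhom := pow_mul_of_commutator_exponent M (c + 2) _ hK hMK
      have hk : ∃ g : Q, π w = π g ^ N := by
        induction hw using closure_induction with
        | mem w hw => obtain ⟨g, rfl⟩ := hw; exact ⟨g, map_pow π g _⟩
        | one => exact ⟨1, by simp⟩
        | mul a b _ _ ha hb =>
          obtain ⟨x, hx⟩ := ha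
          obtain ⟨y, hy⟩ := hb
          exact ⟨x * y, by rw [map_mul, map_mul, hx, hy, (hhom _ _).2]⟩
        | inv a _ ha => obtain ⟨x, hx⟩ := ha; exact ⟨x⁻¹, by rw [map_inv, map_inv, hx, inv_pow]⟩
      obtain ⟨g, hg⟩ := hk
      have hr : (g ^ N)⁻¹ * w ∈ closure S := by
        rw [← hRS]
        refine (QuotientGroup.eq_one_iff _).1 ?_
        change π _ = 1
        rw [map_mul, map_inv, hg, map_pow, inv_mul_cancel]
      let H := zpowers g ⊔ commutator Q
      have hH := lcs_zpowers_sup_commutator_eq_bot g c hc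
      let P : Subgroup H := closure (Set.range fun h : H => h ^ M)
      have hgP : g ^ N ∈ P.map H.subtype := by
        have hdvd : M ∣ N := dvd_pow_self M (by omega)
        obtain ⟨k, hk⟩ := hdvd
        refine ⟨(⟨g, mem_sup_left (mem_zpowers g)⟩ : H) ^ N, ?_, by simp⟩
        rw [hk, mul_comm M k, pow_mul]
        exact subset_closure ⟨_, rfl⟩
      have hrP : closure S ≤ P.map H.subtype := by
        rw [closure_le]
        rintro _ ⟨u, hu, rfl⟩
        exact ⟨(⟨u, mem_sup_right hu⟩ : H) ^ M, subset_closure ⟨_, rfl⟩, by simp⟩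
      have hwP : w ∈ P.map H.subtype := by
        have := mul_mem hgP (hrP hr)
        rwa [mul_inv_cancel_left] at this
      obtain ⟨w', hw', rfl⟩ := hwP
      obtain ⟨z, hz⟩ := he H m hH w' hw'
      exact ⟨z, by rw [hz]; simp⟩

/-! ### The torsion subgroup and the elements of infinite `p`-height -/

/-- The torsion subgroup of a nilpotent group, consisting of all elements of finite order. -/
def torsionSubgroup (G : Type*) [Group G] [Group.IsNilpotent G] : Subgroup G where
  carrier := {g | IsOfFinOrder g}
  one_mem' := IsOfFinOrder.one
  mul_mem' := by
    intro x y hx hy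
    obtain ⟨c, hc⟩ := Subgroup.nilpotent_iff_lowerCentralSeries.1 (inferInstance : Group.IsNilpotent G)
    exact isOfFinOrder_mul_of_lcs c G hc x y hx hy
  inv_mem' := fun h => h.inv

/-- `g` has infinite `p`-height in `G`: for all `i` and `j` there are `x ∈ G` and `y ∈ γ_j(G)` with
`x ^ (p ^ i) = g * y`. Here `γ_{j+1}(G)` is `lowerCentralSeries j`, with `γ_1(G) = G`. -/
def HasInfiniteHeight (p : ℕ) {G : Type*} [Group G] (g : G) : Prop :=
  ∀ i j : ℕ, ∃ x : G, ∃ y ∈ (⊤ : Subgroup G).lowerCentralSeries j, x ^ p ^ i = g * y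

theorem hasInfiniteHeight_iff (p : ℕ) {G : Type*} [Group G] (g : G) :
    HasInfiniteHeight p g ↔ ∀ i j : ℕ, ∃ z : G ⧸ (⊤ : Subgroup G).lowerCentralSeries j,
      z ^ p ^ i = (g : G ⧸ (⊤ : Subgroup G).lowerCentralSeries j) := by
  refine forall₂_congr fun i j => ⟨?_, ?_⟩
  · rintro ⟨x, y, hy, h⟩
    refine ⟨x, ?_⟩
    rw [← QuotientGroup.mk_pow, h]
    exact QuotientGroup.mk_mul_of_mem g hy
  · rintro ⟨z, hz⟩
    obtain ⟨x, rfl⟩ := QuotientGroup.mk_surjective z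
    rw [← QuotientGroup.mk_pow] at hz
    exact ⟨x, g⁻¹ * x ^ p ^ i, QuotientGroup.eq.1 hz.symm, by group⟩

/-- The subgroup `G(p)` of `G`, consisting of the elements of infinite `p`-height in `G`. -/
def infiniteHeightSubgroup (p : ℕ) (G : Type*) [Group G] : Subgroup G where
  carrier := {g | HasInfiniteHeight p g}
  one_mem' := fun i _ => ⟨1, 1, one_mem _, by simp⟩
  mul_mem' := by
    intro a b ha hb
    refine (hasInfiniteHeight_iff p _).2 fun i j => ?_
    obtain ⟨e, he⟩ := exists_pow_of_mem_closure_pow j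
    let π := QuotientGroup.mk' ((⊤ : Subgroup G).lowerCentralSeries j)
    have hQ : (⊤ : Subgroup (G ⧸ (⊤ : Subgroup G).lowerCentralSeries j)).lowerCentralSeries j
        = ⊥ := by
      rw [← map_top_of_surjective π (QuotientGroup.mk'_surjective _), ← map_lowerCentralSeries]
      exact QuotientGroup.map_mk'_self _
    obtain ⟨x, hx⟩ := (hasInfiniteHeight_iff p a).1 ha (i * e) j
    obtain ⟨y, hy⟩ := (hasInfiniteHeight_iff p b).1 hb (i * e) j
    rw [pow_mul] at hx hy
    obtain ⟨z, hz⟩ := he _ (p ^ i) hQ (x ^ (p ^ i) ^ e * y ^ (p ^ i) ^ e)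
      (mul_mem (subset_closure ⟨x, rfl⟩) (subset_closure ⟨y, rfl⟩))
    exact ⟨z, by rw [← hz, hx, hy, QuotientGroup.mk_mul]⟩
  inv_mem' := by
    intro a ha
    refine (hasInfiniteHeight_iff p _).2 fun i j => ?_
    obtain ⟨x, hx⟩ := (hasInfiniteHeight_iff p a).1 ha i j
    exact ⟨x⁻¹, by rw [inv_pow, hx, QuotientGroup.mk_inv]⟩

end GroupRingUnits

/-! Any unit lying in `1 + Δⁿ` for every `n` must be `1`, so the proof manufactures such units from
torsion elements. If `h` has order `n` with `φ(n) > 2`, then `ℤ[ζₙ]` has a unit of infinite order,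
and a power of it lifts to a nontrivial unit `1 + Q(h)s(h)` for any `Q` not vanishing at `ζₙ`. Hence
`Q(h) ∈ ⋂ Δⁿ` forces `Φₙ ∣ Q` (`cyclotomic_dvd_of_aeval_mem`).

Two sources feed this criterion. For `g`, `h` of coprime orders, `(g - 1)(h - 1)` lies in every
`Δⁿ`; so they commute, and applying the criterion to `gh` leaves only orders 2 and 3
(`mul_eq_six_of_coprime`). Thus `T` is a `p`-group or has exponent 6. For `g` of `p`-power order and
infinite `p`-height, `(g - 1)²` lies in every `Δⁿ`, so `g` has order at most 4.

Commutativity of `T(p)` comes instead from the bicyclic units `1 + (h - 1)xĥ`, where `ĥ` is the sum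
of the powers of `h`: their triviality makes `x` normalize `⟨h⟩`, and a cyclic group of order at
most 4 has no automorphisms except the identity and inversion, so `x²` centralizes `h`. -/

namespace GroupRingUnits

/-! ### Cyclotomic units and units of `ℤ[X]/(Xⁿ - 1)`. -/

section CyclotomicUnits

open Polynomial

/-- The sum is `(ζᵏ - 1)/(ζ - 1)`, and `|ζᵐ - 1| = 2 sin(πm/n)` increases strictly for `m ≤ n/2`.
This shows that the cyclotomic unit has infinite order. -/
theorem one_lt_norm_geom_sum_exp {n k : ℕ} (hk : 2 ≤ k) (hkn : 2 * k ≤ n) :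
    1 < ‖∑ i ∈ Finset.range k, Complex.exp (2 * Real.pi * Complex.I / n) ^ i‖ := by
  set ζ := Complex.exp (2 * Real.pi * Complex.I / n) with hζ
  have hn : (0 : ℝ) < n := by exact_mod_cast (by omega : 0 < n)
  have hnorm : ∀ m : ℕ, 2 * m ≤ n → ‖ζ ^ m - 1‖ = 2 * Real.sin (Real.pi * m / n) := by
    intro m hm
    have hm' : (2 * m : ℝ) ≤ n := by exact_mod_cast hm
    have h1 : ζ ^ m = Complex.exp (Complex.I * ((2 * Real.pi * m / n : ℝ) : ℂ)) := by
      rw [hζ, ← Complex.exp_nat_mul]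
      congr 1
      push_cast
      ring
    have h2 : 0 ≤ Real.sin (Real.pi * m / n) := by
      apply Real.sin_nonneg_of_nonneg_of_le_pi (by positivity)
      rw [div_le_iff₀ hn]
      exact mul_le_mul_of_nonneg_left (by linarith [Nat.cast_nonneg (α := ℝ) m]) Real.pi_pos.le
    rw [h1, Complex.norm_exp_I_mul_ofReal_sub_one, Real.norm_of_nonneg] <;>
      rw [show 2 * Real.pi * m / n / 2 = Real.pi * m / n by ring]
    positivity
  have hlt : ‖ζ ^ 1 - 1‖ < ‖ζ ^ k - 1‖ := by
    rw [hnorm 1 (by omega), hnorm k hkn]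
    have hk' : (2 * k : ℝ) ≤ n := by exact_mod_cast hkn
    have h1k : (1 : ℝ) < k := by exact_mod_cast hk
    have hb : ∀ m : ℝ, 0 ≤ m → m ≤ k → Real.pi * m / n ∈ Set.Icc (-(Real.pi / 2)) (Real.pi / 2) := by
      intro m h0 hm
      refine ⟨le_trans (by linarith [Real.pi_pos]) (show (0 : ℝ) ≤ _ by positivity), ?_⟩
      rw [div_le_iff₀ hn]
      nlinarith [Real.pi_pos]
    refine mul_lt_mul_of_pos_left (Real.strictMonoOn_sin (hb _ (by simp) (by push_cast; linarith))
      (hb _ (by positivity) le_rfl) ?_) two_pos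
    push_cast
    exact div_lt_div_of_pos_right (mul_lt_mul_of_pos_left h1k Real.pi_pos) hn
  rw [pow_one, ← geom_sum_mul, norm_mul] at hlt
  by_contra! h
  exact absurd hlt (not_lt.2 (mul_le_of_le_one_left (norm_nonneg _) h))

theorem exists_coprime_of_five_le {n : ℕ} (hn : 5 ≤ n) (h6 : n ≠ 6) :
    ∃ k, 2 ≤ k ∧ 2 * k ≤ n ∧ k.Coprime n := by
  -- The choices are `k = 2`, `k = n/2 - 1` and `k = n/2 - 2` respectively; the last needs `n ≥ 10`,
  -- which is where `n ≠ 6` enters.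
  rcases (by omega : n % 2 = 1 ∨ n % 4 = 0 ∨ n % 4 = 2) with h | h | h
  · exact ⟨2, le_rfl, by omega, Nat.coprime_two_left.2 (Nat.odd_iff.2 h)⟩
  · obtain ⟨m, rfl⟩ : ∃ m, n = 4 * m := ⟨n / 4, by omega⟩
    refine ⟨2 * m - 1, by omega, by omega, ?_⟩
    obtain ⟨j, rfl⟩ : ∃ j, m = j + 1 := ⟨m - 1, by omega⟩
    rw [show 2 * (j + 1) - 1 = 2 * j + 1 by omega, show 4 * (j + 1) = 2 + (2 * j + 1) * 2 by ring,
      Nat.coprime_add_mul_left_right, Nat.coprime_two_right]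
    exact ⟨j, rfl⟩
  · obtain ⟨m, rfl⟩ : ∃ m, n = 4 * m + 10 := ⟨(n - 10) / 4, by omega⟩
    refine ⟨2 * m + 3, by omega, by omega, ?_⟩
    rw [show 4 * m + 10 = 2 ^ 2 + (2 * m + 3) * 2 by ring,
      Nat.coprime_add_mul_left_right]
    exact Nat.Coprime.pow_right 2 (Nat.coprime_two_right.2 ⟨m + 1, by ring⟩)

theorem not_cyclotomic_dvd_X_pow_sub_one {n a : ℕ} (ha : 0 < a) (han : a < n) :
    ¬ cyclotomic n ℤ ∣ X ^ a - 1 := by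
  rintro ⟨s, hs⟩
  have hn : n ≠ 0 := by omega
  have hζ := Complex.isPrimitiveRoot_exp n hn
  have h1 := congrArg (aeval (Complex.exp (2 * Real.pi * Complex.I / n))) hs
  have h0 : aeval (Complex.exp (2 * Real.pi * Complex.I / n)) (cyclotomic n ℤ) = 0 := by
    rw [cyclotomic_eq_minpoly hζ (Nat.pos_of_ne_zero hn)]; exact minpoly.aeval _ _
  rw [map_mul, h0, zero_mul] at h1
  simp only [map_sub, map_pow, aeval_X, map_one, sub_eq_zero] at h1
  exact absurd (Nat.le_of_dvd ha (hζ.dvd_of_pow_eq_one _ h1)) (by omega)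

/-- If `φ(n) > 2` and `Q` does not vanish at the primitive `n`-th roots of unity, then
`ℤ[X]/(Xⁿ - 1)` has a nontrivial unit that is congruent to `1` modulo `Q`. -/
theorem exists_polynomial_unit {n : ℕ} (hn : 5 ≤ n) (h6 : n ≠ 6) (Q : ℤ[X]) (hQ : ¬ cyclotomic n ℤ ∣ Q) :
    ∃ s s' : ℤ[X], X ^ n - 1 ∣ (1 + Q * s) * (1 + Q * s') - 1 ∧ ¬ X ^ n - 1 ∣ Q * s := by
  have hn0 : n ≠ 0 := by omega
  obtain ⟨k, hk, hkn, hcop⟩ := exists_coprime_of_five_le hn h6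
  set Φ := cyclotomic n ℤ with hΦ
  have hmon : Φ.Monic := cyclotomic.monic n ℤ
  have hprime : Prime Φ := (cyclotomic.irreducible (by omega)).prime
  have : Fact (Prime Φ) := ⟨hprime⟩
  have : IsDomain (AdjoinRoot Φ) := AdjoinRoot.isDomain_of_prime hprime
  have := hmon.free_adjoinRoot
  have := hmon.finite_adjoinRoot
  obtain ⟨Ψ, hΨ⟩ : Φ ∣ X ^ n - 1 := cyclotomic.dvd_X_pow_sub_one n ℤ
  have hζ := Complex.isPrimitiveRoot_exp n hn0
  set ζ := Complex.exp (2 * Real.pi * Complex.I / n) with hζdef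
  have h0 : aeval ζ Φ = 0 := by
    rw [hΦ, cyclotomic_eq_minpoly hζ (Nat.pos_of_ne_zero hn0)]; exact minpoly.aeval _ _
  -- Otherwise `ζ` would be a double root of `Xⁿ - 1`, against the derivative `nζⁿ⁻¹ ≠ 0`.
  have hΦΨ : ¬ Φ ∣ Ψ := by
    intro ⟨s, hs⟩
    have h1 := congrArg (fun P => aeval ζ (derivative P)) hΨ
    rw [hs] at h1
    have h2 : derivative (X ^ n - 1 : ℤ[X]) = C (n : ℤ) * X ^ (n - 1) := by
      rw [derivative_sub, derivative_X_pow, derivative_one, sub_zero]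
    have h3 : aeval ζ (C (n : ℤ) * X ^ (n - 1) : ℤ[X]) = n * ζ ^ (n - 1) := by simp
    simp only [h2, h3] at h1
    simp [h0, hn0, hζ.ne_zero hn0] at h1
  have hQΨ : AdjoinRoot.mk Φ (Q * Ψ) ≠ 0 := by
    rw [Ne, AdjoinRoot.mk_eq_zero]
    exact fun h => (hprime.dvd_or_dvd h).elim hQ hΦΨ
  -- By integrality the nonzero ideal `(QΨ)` of `ℤ[ζ]` contains a nonzero integer `c`; congruence
  -- modulo `c` has finite index.
  obtain ⟨c, hc, hc0⟩ := (Submodule.ne_bot_iff _).1 (Ideal.comap_ne_bot_of_integral_mem hQΨ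
    (Ideal.mem_span_singleton_self _) (Algebra.IsIntegral.isIntegral (R := ℤ) _))
  obtain ⟨a, ha⟩ := Ideal.mem_span_singleton'.1 (Ideal.mem_comap.1 hc)
  have hI : Ideal.span {algebraMap ℤ (AdjoinRoot Φ) c} ≠ ⊥ := by
    rw [Ne, Ideal.span_singleton_eq_bot]
    exact (map_ne_zero_iff _ (FaithfulSMul.algebraMap_injective ℤ (AdjoinRoot Φ))).2 hc0
  have := Ideal.finiteQuotientOfFreeOfNeBot _ hI
  -- With `kl ≡ 1 (mod n)`, the sum `P' = (X^(kl) - 1)/(X^k - 1)` inverts `P = (X^k - 1)/(X - 1)`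
  -- modulo `Φ`.
  obtain ⟨l, -, hl⟩ := Nat.exists_mul_mod_eq_one_of_coprime hcop (by omega)
  set P : ℤ[X] := ∑ i ∈ Finset.range k, X ^ i with hP
  set P' : ℤ[X] := ∑ i ∈ Finset.range l, (X ^ k) ^ i with hP'
  set mk := AdjoinRoot.mk Φ with hmk
  have hX1 : mk (X - 1) ≠ 0 := by
    rw [Ne, AdjoinRoot.mk_eq_zero]
    simpa using not_cyclotomic_dvd_X_pow_sub_one one_pos (by omega : 1 < n)
  have hXn : mk X ^ n = 1 := by
    rw [← map_pow, ← sub_eq_zero, ← map_one mk, ← map_sub, AdjoinRoot.mk_eq_zero, hΨ]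
    exact dvd_mul_right _ _
  have hww : mk P * mk P' = 1 := by
    refine mul_right_cancel₀ hX1 ?_
    have h1 : P * P' * (X - 1) = X ^ (k * l) - 1 := by
      rw [mul_right_comm, hP, geom_sum_mul, mul_comm, hP', geom_sum_mul, pow_mul]
    rw [← map_mul, ← map_mul, h1, one_mul, map_sub, map_sub, map_pow, ← Nat.mod_add_div (k * l) n,
      hl, pow_add, pow_mul, hXn, one_pow, mul_one, pow_one]
  set q := Ideal.Quotient.mk (Ideal.span {algebraMap ℤ (AdjoinRoot Φ) c}) with hq
  have hqw : q (mk P) * q (mk P') = 1 := by rw [← map_mul, hww, map_one]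
  obtain ⟨N, hN, hwN⟩ := isOfFinOrder_iff_pow_eq_one.1
    (isOfFinOrder_of_finite (Units.mkOfMulEqOne _ _ hqw))
  have hwN1 : q (mk P ^ N) = 1 := by rw [map_pow]; exact congrArg Units.val hwN
  have hwN2 : q (mk P' ^ N) = 1 := by
    have h1 : q (mk P ^ N) * q (mk P' ^ N) = 1 := by
      rw [← map_mul, ← mul_pow, hww, one_pow, map_one]
    rwa [hwN1, one_mul] at h1
  have hlift : ∀ w : AdjoinRoot Φ, q w = 1 →
      ∃ S : ℤ[X], w = mk (1 + Q * (Ψ * S)) := by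
    intro w hw
    rw [← map_one q, hq, Ideal.Quotient.mk_eq_mk_iff_sub_mem,
      Ideal.mem_span_singleton'] at hw
    obtain ⟨v, hv⟩ := hw
    obtain ⟨S, hS⟩ := AdjoinRoot.mk_surjective (v * a)
    refine ⟨S, ?_⟩
    rw [← mul_assoc, map_add, map_one, map_mul, hS, ← sub_eq_iff_eq_add', ← hv, ← ha]
    ring
  obtain ⟨S, hS⟩ := hlift (mk P ^ N) hwN1
  obtain ⟨S', hS'⟩ := hlift (mk P' ^ N) hwN2
  -- The factor `Ψ` makes the lifted elements `1` modulo `Ψ`, so the inverse relation modulo `Φ`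
  -- extends to one modulo `ΦΨ = Xⁿ - 1`. Were the unit trivial, `P(ζ)ᴺ = 1` would contradict
  -- `|P(ζ)| > 1`.
  refine ⟨Ψ * S, Ψ * S', ?_, fun hdvd => ?_⟩
  · have h1 : Φ ∣ (1 + Q * (Ψ * S)) * (1 + Q * (Ψ * S')) - 1 := by
      rw [← AdjoinRoot.mk_eq_zero, map_sub, map_mul, ← hmk, ← hS, ← hS', ← mul_pow, hww, one_pow,
        map_one, sub_self]
    rw [show (1 + Q * (Ψ * S)) * (1 + Q * (Ψ * S')) - 1
      = Ψ * (Q * S + Q * S' + Q * S * (Q * (Ψ * S'))) by ring] at h1 ⊢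
    rw [hΨ, mul_comm Φ]
    exact mul_dvd_mul_left _ ((hprime.dvd_or_dvd h1).resolve_left hΦΨ)
  · rw [hΨ] at hdvd
    have h1 := AdjoinRoot.mk_eq_zero.2 ((dvd_mul_right _ _).trans hdvd)
    rw [map_add, hmk, h1, add_zero, map_one, ← sub_eq_zero, ← map_pow, ← map_one (AdjoinRoot.mk Φ), ← map_sub,
      AdjoinRoot.mk_eq_zero] at hS
    obtain ⟨R, hR⟩ := hS
    have h2 := congrArg (aeval ζ) hR
    rw [map_mul, h0, zero_mul, map_sub, map_one, map_pow, sub_eq_zero, hP, map_sum] at h2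
    simp only [map_pow, aeval_X] at h2
    have h3 := congrArg norm h2
    rw [norm_pow, norm_one] at h3
    exact (one_lt_pow₀ (one_lt_norm_geom_sum_exp hk hkn) hN.ne').ne' h3

end CyclotomicUnits

/-! ### Elements of the residue `⋂ₙ Δⁿ(G)`, and the units they produce. -/

section AugmentationPowers

open MonoidAlgebra (of)

instance (G : Type*) [Group G] : (augmentationIdeal G).IsTwoSided :=
  inferInstanceAs (RingHom.ker (augmentation G)).IsTwoSided

variable {G : Type*} [Group G]

theorem mul_mem_augmentationIdeal_pow_succ {a b : MonoidAlgebra ℤ G} {n : ℕ}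
    (ha : a ∈ augmentationIdeal G) (hb : b ∈ augmentationIdeal G ^ n) :
    a * b ∈ augmentationIdeal G ^ (n + 1) := by
  rw [Ideal.IsTwoSided.pow_succ]
  exact Ideal.mul_mem_mul ha hb

theorem of_sub_one_mem_augmentationIdeal (g : G) : of ℤ G g - 1 ∈ augmentationIdeal G := by
  simp [augmentationIdeal, RingHom.mem_ker, augmentation]

theorem geom_sum_sub_natCast_mem_augmentationIdeal (g : G) (a : ℕ) :
    ∑ i ∈ Finset.range a, of ℤ G g ^ i - (a : MonoidAlgebra ℤ G) ∈ augmentationIdeal G := by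
  have : ∑ i ∈ Finset.range a, of ℤ G g ^ i - (a : MonoidAlgebra ℤ G)
      = ∑ i ∈ Finset.range a, (of ℤ G (g ^ i) - 1) := by simp
  rw [this]
  exact sum_mem fun i _ => of_sub_one_mem_augmentationIdeal _

/-- The sum `s = 1 + g + ⋯ + gᵃ⁻¹` annihilates `g - 1` and is `a` modulo `Δ`, so multiplying a
multiple of `g - 1` by `a` amounts to multiplying it by `-(s - a) ∈ Δ`. -/
theorem natCast_pow_mul_of_sub_one_mem {g : G} {a : ℕ} (hg : g ^ a = 1) (k : ℕ) :
    (a : MonoidAlgebra ℤ G) ^ k * (of ℤ G g - 1) ∈ augmentationIdeal G ^ (k + 1) := by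
  induction k with
  | zero => simpa [Submodule.pow_one] using of_sub_one_mem_augmentationIdeal g
  | succ k ih =>
    set s := ∑ i ∈ Finset.range a, of ℤ G g ^ i with hs
    have h0 : s * (of ℤ G g - 1) = 0 := by
      rw [hs, geom_sum_mul, ← map_pow, hg, map_one, sub_self]
    have hc : s * (a : MonoidAlgebra ℤ G) ^ k = (a : MonoidAlgebra ℤ G) ^ k * s :=
      ((Nat.cast_commute a s).pow_left k).symm.eq
    have : (a : MonoidAlgebra ℤ G) ^ (k + 1) * (of ℤ G g - 1)
        = -((s - a) * ((a : MonoidAlgebra ℤ G) ^ k * (of ℤ G g - 1))) := by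
      rw [sub_mul, ← mul_assoc s, hc, mul_assoc, h0, mul_zero, zero_sub, neg_neg, ← mul_assoc,
        pow_succ']
    rw [this]
    exact neg_mem (mul_mem_augmentationIdeal_pow_succ
      (geom_sum_sub_natCast_mem_augmentationIdeal g a) ih)

/-- The residue `⋂ₙ Δⁿ(G)` contains the products of elements of `Δ` of coprime exponents. -/
theorem of_sub_one_mul_of_sub_one_mem_of_coprime {g h : G} {a b : ℕ} (hab : a.Coprime b)
    (hg : g ^ a = 1) (hh : h ^ b = 1) (n : ℕ) :
    (of ℤ G g - 1) * (of ℤ G h - 1) ∈ augmentationIdeal G ^ n := by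
  obtain ⟨u, v, huv⟩ := Int.isCoprime_iff_gcd_eq_one.2
    (show Int.gcd ((a ^ n : ℕ) : ℤ) ((b ^ n : ℕ) : ℤ) = 1 from (hab.pow n n))
  have h1 : ((u * (a ^ n : ℕ) + v * (b ^ n : ℕ) : ℤ) : MonoidAlgebra ℤ G) = 1 := by
    rw [huv, Int.cast_one]
  push_cast at h1
  have hc : (of ℤ G g - 1) * (b : MonoidAlgebra ℤ G) ^ n
      = (b : MonoidAlgebra ℤ G) ^ n * (of ℤ G g - 1) :=
    ((Nat.cast_commute b _).pow_left n).symm.eq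
  have h2 : (of ℤ G g - 1) * (of ℤ G h - 1)
      = u * ((a : MonoidAlgebra ℤ G) ^ n * (of ℤ G g - 1) * (of ℤ G h - 1))
        + v * ((of ℤ G g - 1) * ((b : MonoidAlgebra ℤ G) ^ n * (of ℤ G h - 1))) := by
    rw [← mul_assoc _ ((b : MonoidAlgebra ℤ G) ^ n), hc]
    simp only [← mul_assoc]
    rw [← add_mul, ← add_mul, h1, one_mul]
  have hle : augmentationIdeal G ^ (n + 1) ≤ augmentationIdeal G ^ n :=
    Ideal.pow_le_pow_right (Nat.le_succ n)
  rw [h2]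
  exact add_mem
    (Ideal.mul_mem_left _ _ (Ideal.mul_mem_right _ _ (hle (natCast_pow_mul_of_sub_one_mem hg n))))
    (Ideal.mul_mem_left _ _ (Ideal.mul_mem_left _ _ (hle (natCast_pow_mul_of_sub_one_mem hh n))))

/-- The residue `⋂ₙ Δⁿ(G)` contains `(g - 1) α (h - 1)` if `h` has finite order dividing `a` and
`g` is an `aⁿ`-th power for all `n`. -/
theorem of_sub_one_mul_mul_of_sub_one_mem {g h : G} {a : ℕ} (hg : ∀ n, ∃ x : G, x ^ a ^ n = g)
    (hh : h ^ a = 1) (α : MonoidAlgebra ℤ G) (n : ℕ) :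
    (of ℤ G g - 1) * α * (of ℤ G h - 1) ∈ augmentationIdeal G ^ n := by
  obtain ⟨x, rfl⟩ := hg n
  -- The extra factor `aᵏ` makes the induction on `m` close: `yᵃ - 1 = s(y - 1)` with `s = (s - a) +
  -- a`, where `s - a` contributes a factor in `Δ` and `a` raises `k` by one.
  suffices H : ∀ m k : ℕ, (a : MonoidAlgebra ℤ G) ^ k *
      ((of ℤ G (x ^ a ^ m) - 1) * α * (of ℤ G h - 1)) ∈ augmentationIdeal G ^ (m + k) by
    simpa using H n 0
  intro m
  induction m with
  | zero =>
    intro k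
    have hc := ((Nat.cast_commute a ((of ℤ G (x ^ a ^ 0) - 1) * α)).pow_left k).eq
    rw [← mul_assoc, hc, mul_assoc, zero_add]
    exact Ideal.mul_mem_left _ _
      (Ideal.pow_le_pow_right (Nat.le_succ k) (natCast_pow_mul_of_sub_one_mem hh k))
  | succ m ih =>
    intro k
    set y := x ^ a ^ m with hy
    set s := ∑ i ∈ Finset.range a, of ℤ G y ^ i with hs
    set w := (of ℤ G y - 1) * α * (of ℤ G h - 1) with hw
    have h1 : (of ℤ G (x ^ a ^ (m + 1)) - 1) * α * (of ℤ G h - 1) = s * w := by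
      rw [pow_succ, pow_mul, map_pow, ← geom_sum_mul, hw]
      simp only [mul_assoc, hs, hy]
    have hc : s * (a : MonoidAlgebra ℤ G) ^ k = (a : MonoidAlgebra ℤ G) ^ k * s :=
      ((Nat.cast_commute a s).pow_left k).symm.eq
    have h2 : (a : MonoidAlgebra ℤ G) ^ k * (s * w)
        = (s - a) * ((a : MonoidAlgebra ℤ G) ^ k * w) + (a : MonoidAlgebra ℤ G) ^ (k + 1) * w := by
      rw [sub_mul, ← mul_assoc s _ w, hc, ← mul_assoc (a : MonoidAlgebra ℤ G) _ w, ← pow_succ',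
        mul_assoc, sub_add_cancel]
    rw [h1, h2, show m + 1 + k = m + k + 1 by ring]
    exact add_mem (mul_mem_augmentationIdeal_pow_succ
      (geom_sum_sub_natCast_mem_augmentationIdeal y a) (ih k)) (ih (k + 1))

theorem eq_one_of_deltaAdicResidue_eq_bot (hG : deltaAdicResidue G = ⊥)
    {u v : MonoidAlgebra ℤ G} (huv : u * v = 1) (hvu : v * u = 1)
    (hu : ∀ n, u - 1 ∈ augmentationIdeal G ^ n) : u = 1 := by
  have h : (⟨u, v, huv, hvu⟩ : (MonoidAlgebra ℤ G)ˣ) ∈ deltaAdicResidue G := by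
    simp only [deltaAdicResidue, Subgroup.mem_iInf]
    refine fun n _ => ⟨?_, hu n⟩
    have h1 := hu 1
    rw [Submodule.pow_one] at h1
    rw [normalizedUnits, MonoidHom.mem_ker]
    ext
    simpa [augmentationIdeal, RingHom.mem_ker, sub_eq_zero] using h1
  rw [hG, Subgroup.mem_bot] at h
  exact congrArg Units.val h

/-- The commutator is itself a unit in the residue, because `gh - hg = (g - 1)(h - 1) - (h - 1)(g -
1)`. -/
theorem commute_of_coprime (hG : deltaAdicResidue G = ⊥) {g h : G} {a b : ℕ} (hab : a.Coprime b)
    (hg : g ^ a = 1) (hh : h ^ b = 1) : g * h = h * g := by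
  have h1 : of ℤ G (g⁻¹ * h⁻¹ * (g * h)) = 1 := by
    refine eq_one_of_deltaAdicResidue_eq_bot hG (v := of ℤ G ((g⁻¹ * h⁻¹ * (g * h))⁻¹))
      (by rw [← map_mul, mul_inv_cancel, map_one]) (by rw [← map_mul, inv_mul_cancel, map_one])
      fun n => ?_
    have h2 : of ℤ G (g⁻¹ * h⁻¹ * (g * h)) - 1 = of ℤ G (g⁻¹ * h⁻¹) *
        ((of ℤ G g - 1) * (of ℤ G h - 1) - (of ℤ G h - 1) * (of ℤ G g - 1)) := by
      have : of ℤ G (g⁻¹ * h⁻¹ * (h * g)) = 1 := by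
        rw [← map_one (of ℤ G)]; congr 1; group
      conv_lhs => rw [← this]
      rw [map_mul _ _ (g * h), map_mul _ _ (h * g), ← mul_sub, map_mul _ g h, map_mul _ h g]
      congr 1
      noncomm_ring
    rw [h2]
    exact Ideal.mul_mem_left _ _ (sub_mem (of_sub_one_mul_of_sub_one_mem_of_coprime hab hg hh n)
      (of_sub_one_mul_of_sub_one_mem_of_coprime hab.symm hh hg n))
  rw [← map_one (of ℤ G)] at h1
  have h2 := MonoidAlgebra.of_injective h1
  rw [← mul_inv_rev, inv_mul_eq_one] at h2
  exact h2.symm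

/-- If the bicyclic unit `1 + (h - 1) x ĥ` is trivial then `x` normalizes the subgroup generated
by `h`. -/
theorem conj_mem_zpowers_of_mul_geom_sum_eq_zero {h x : G} {n : ℕ} (hn : 0 < n)
    (H : (of ℤ G h - 1) * of ℤ G x * ∑ i ∈ Finset.range n, of ℤ G h ^ i = 0) :
    x⁻¹ * h * x ∈ Subgroup.zpowers h := by
  classical
  rw [sub_mul, sub_mul, one_mul, sub_eq_zero] at H
  simp only [Finset.mul_sum, ← map_pow, ← map_mul] at H
  -- In `xĥ = hxĥ` the element `hx` has positive coefficient on the right, hence occurs as some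
  -- `xhⁱ` on the left.
  have h1 := congrArg (fun z : MonoidAlgebra ℤ G => z.coeff (h * x)) H
  simp only [MonoidAlgebra.coeff_sum, Finsupp.finsetSum_apply, MonoidAlgebra.of_apply,
    MonoidAlgebra.coeff_single, Finsupp.single_apply] at h1
  have h2 : 0 < ∑ i ∈ Finset.range n, if h * x * h ^ i = h * x then (1 : ℤ) else 0 :=
    Finset.sum_pos' (fun i _ => by split_ifs <;> simp) ⟨0, by simpa using hn, by simp⟩
  rw [h1] at h2
  obtain ⟨i, -, hi⟩ := Finset.exists_ne_zero_of_sum_ne_zero h2.ne'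
  have h3 : x * h ^ i = h * x := by by_contra h; simp [h] at hi
  refine ⟨i, ?_⟩
  rw [mul_assoc, ← h3]
  simp

end AugmentationPowers

/-! ### Consequences of a trivial residue for orders and normalizers. -/

section TrivialResidue

open MonoidAlgebra (of)
open Polynomial

variable {G : Type*} [Group G]

theorem aeval_X_pow_orderOf_sub_one (h : G) :
    aeval (of ℤ G h) (X ^ orderOf h - 1 : ℤ[X]) = 0 := by
  rw [map_sub, map_pow, aeval_X, ← map_pow, pow_orderOf_eq_one, map_one, map_one, sub_self]

/-- The powers of `h` below its order are distinct group elements, hence linearly independent, so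
the remainder modulo `Xⁿ - 1` vanishes. This embeds `ℤ[X]/(Xⁿ - 1)` in `ℤG`. -/
theorem X_pow_orderOf_sub_one_dvd_of_aeval_eq_zero {h : G} (hh : 0 < orderOf h) {P : ℤ[X]}
    (hP : aeval (of ℤ G h) P = 0) : X ^ orderOf h - 1 ∣ P := by
  classical
  have hmon : (X ^ orderOf h - 1 : ℤ[X]).Monic := by simpa using monic_X_pow_sub_C (1 : ℤ) hh.ne'
  rw [← modByMonic_eq_zero_iff_dvd hmon]
  set R := P %ₘ (X ^ orderOf h - 1) with hR
  have hdeg : R.natDegree < orderOf h := by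
    have h1 : (X ^ orderOf h - 1 : ℤ[X]).natDegree = orderOf h := by
      simpa using natDegree_X_pow_sub_C (n := orderOf h) (r := (1 : ℤ))
    have h2 := natDegree_modByMonic_lt P hmon (fun h0 => by simp [h0] at h1; omega)
    rwa [h1] at h2
  have hR0 : aeval (of ℤ G h) R = 0 := by
    have h1 := congrArg (aeval (of ℤ G h)) (modByMonic_add_div P (X ^ orderOf h - 1))
    rwa [hP, map_add, map_mul, aeval_X_pow_orderOf_sub_one, zero_mul, add_zero] at h1
  rw [R.as_sum_range' _ hdeg, map_sum] at hR0
  ext j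
  rw [coeff_zero]
  rcases lt_or_ge j (orderOf h) with hj | hj
  · have h1 := congrArg (fun z : MonoidAlgebra ℤ G => z.coeff (h ^ j)) hR0
    simp only [aeval_monomial, ← map_pow] at h1
    simp only [MonoidAlgebra.coeff_sum, Finsupp.finsetSum_apply, MonoidAlgebra.of_apply, ← Algebra.smul_def, MonoidAlgebra.coeff_smul, Finsupp.smul_apply,
      MonoidAlgebra.coeff_single, Finsupp.single_apply] at h1
    rw [Finset.sum_eq_single j] at h1
    · simpa using h1
    · intro i hi hij
      rw [if_neg, smul_zero]
      exact fun h2 => hij (pow_injOn_Iio_orderOf (Finset.mem_range.1 hi) hj h2)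
    · exact fun h2 => absurd (Finset.mem_range.2 hj) h2
  · exact coeff_eq_zero_of_natDegree_lt (hdeg.trans_le hj)

/-- Otherwise the unit `1 + Qs` of `exists_polynomial_unit`, evaluated at `h`, would be a nontrivial
member of the residue. -/
theorem cyclotomic_dvd_of_aeval_mem (hG : deltaAdicResidue G = ⊥) {h : G} (hn : 5 ≤ orderOf h)
    (h6 : orderOf h ≠ 6) {Q : ℤ[X]} (hQ : ∀ n, aeval (of ℤ G h) Q ∈ augmentationIdeal G ^ n) :
    cyclotomic (orderOf h) ℤ ∣ Q := by
  by_contra hQ'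
  obtain ⟨s, s', ⟨r, hr⟩, hs⟩ := exists_polynomial_unit hn h6 Q hQ'
  have huv : aeval (of ℤ G h) (1 + Q * s) * aeval (of ℤ G h) (1 + Q * s') = 1 := by
    rw [← map_mul, ← sub_eq_zero, ← map_one (aeval (R := ℤ) (of ℤ G h)), ← map_sub, hr,
      map_mul, aeval_X_pow_orderOf_sub_one, zero_mul]
  have h1 := eq_one_of_deltaAdicResidue_eq_bot hG huv (by rwa [← map_mul, mul_comm, map_mul])
    fun n => by
      rw [map_add, map_one, add_sub_cancel_left, map_mul]
      exact Ideal.mul_mem_right _ _ (hQ n)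
  rw [map_add, map_one, add_eq_left] at h1
  exact hs (X_pow_orderOf_sub_one_dvd_of_aeval_eq_zero (by omega) h1)

/-- Under `𝒱_ω = 1` commuting elements of coprime orders greater than one have orders two
and three. -/
theorem mul_eq_six_of_coprime (hG : deltaAdicResidue G = ⊥) {g h : G}
    (hco : (orderOf g).Coprime (orderOf h)) (hg : 1 < orderOf g) (hh : 1 < orderOf h) :
    orderOf g * orderOf h = 6 := by
  have hcomm : Commute g h := commute_of_coprime hG hco (pow_orderOf_eq_one g)
    (pow_orderOf_eq_one h)
  have hord := hcomm.orderOf_mul_eq_mul_orderOf_of_coprime hco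
  set a := orderOf g with ha
  set b := orderOf h with hb
  by_contra h6
  have h4 : 4 ≤ a * b := Nat.mul_le_mul hg hh
  have h5 : 5 ≤ a * b := by
    refine lt_of_le_of_ne h4 fun h => ?_
    have ha2 : a = 2 := by nlinarith
    have hb2 : b = 2 := by nlinarith
    rw [ha2, hb2] at hco
    norm_num at hco
  have hab : a < a * b := lt_mul_of_one_lt_right (by omega) hh
  have hba : b < a * b := lt_mul_of_one_lt_left (by omega) hg
  -- The elements `(gh)ᵇ` and `(gh)ᵃ` have coprime exponents `a` and `b`, while a primitive `ab`-th
  -- root of unity is a root of neither factor.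
  have := cyclotomic_dvd_of_aeval_mem hG (h := g * h) (by rwa [hord]) (by rwa [hord])
    (Q := (X ^ b - 1) * (X ^ a - 1)) fun n => by
      simp only [map_mul (aeval _), map_sub, map_pow, aeval_X, map_one]
      rw [← map_pow, ← map_pow]
      exact of_sub_one_mul_of_sub_one_mem_of_coprime hco
        (by rw [← pow_mul, mul_comm b a, ← hord, pow_orderOf_eq_one])
        (by rw [← pow_mul, ← hord, pow_orderOf_eq_one]) n
  rw [hord] at this
  rcases (cyclotomic.irreducible (by omega)).prime.dvd_or_dvd this with h | h
  · exact not_cyclotomic_dvd_X_pow_sub_one (by omega) hba h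
  · exact not_cyclotomic_dvd_X_pow_sub_one (by omega) hab h

/-- Elements `g` that are `aⁿ`-th powers for all `n` and satisfy `g ^ a = 1` have order at most
four or equal to six. -/
theorem orderOf_lt_five_of_divisible (hG : deltaAdicResidue G = ⊥) {g : G} {a : ℕ}
    (hdiv : ∀ n, ∃ x : G, x ^ a ^ n = g) (hg : g ^ a = 1) (h6 : orderOf g ≠ 6) :
    orderOf g < 5 := by
  by_contra! h5
  have := cyclotomic_dvd_of_aeval_mem hG h5 h6 (Q := (X ^ 1 - 1) * (X ^ 1 - 1)) fun n => by
    have := of_sub_one_mul_mul_of_sub_one_mem hdiv hg 1 n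
    rw [mul_one] at this
    simpa only [map_mul (aeval _), map_sub, pow_one, aeval_X, map_one] using this
  rcases (cyclotomic.irreducible (by omega)).prime.dvd_or_dvd this with h | h <;>
  exact not_cyclotomic_dvd_X_pow_sub_one one_pos (by omega) h

/-- The element `b = (h - 1)xĥ` has square zero, so `1 + b` is a unit. As `(h - 1)ĥ = 0`, also `b =
(h - 1)(x - 1)ĥ`, which lies in every `Δᵏ`; hence `b = 0`. -/
theorem conj_mem_zpowers_of_divisible (hG : deltaAdicResidue G = ⊥) {h x : G} {a n : ℕ}
    (hdiv : ∀ n, ∃ y : G, y ^ a ^ n = h) (hx : x ^ a = 1) (hn : 0 < n) (hh : h ^ n = 1) :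
    x⁻¹ * h * x ∈ Subgroup.zpowers h := by
  refine conj_mem_zpowers_of_mul_geom_sum_eq_zero hn ?_
  set s := ∑ i ∈ Finset.range n, of ℤ G h ^ i with hs
  have h0 : s * (of ℤ G h - 1) = 0 := by rw [hs, geom_sum_mul, ← map_pow, hh, map_one, sub_self]
  have h0' : (of ℤ G h - 1) * s = 0 := by
    rw [hs, mul_geom_sum, ← map_pow, hh, map_one, sub_self]
  set b := (of ℤ G h - 1) * of ℤ G x * s with hb
  have hbb : b * b = 0 := by
    rw [hb]
    calc _ = (of ℤ G h - 1) * of ℤ G x * (s * (of ℤ G h - 1)) * of ℤ G x * s := by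
          simp only [mul_assoc]
      _ = 0 := by rw [h0]; simp
  have hb' : b = (of ℤ G h - 1) * 1 * (of ℤ G x - 1) * s := by
    rw [mul_one, mul_sub, mul_one, sub_mul _ _ s, h0', sub_zero]
  have := eq_one_of_deltaAdicResidue_eq_bot hG (u := 1 + b) (v := 1 - b)
    (by rw [← (Commute.one_left b).mul_self_sub_mul_self_eq]; simp [hbb])
    (by rw [← (Commute.one_left b).mul_self_sub_mul_self_eq']; simp [hbb]) fun k => by
      rw [add_sub_cancel_left, hb']
      exact Ideal.mul_mem_right _ _ (of_sub_one_mul_mul_of_sub_one_mem hdiv hx 1 k)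
  simpa using this

/-- If conjugation by `x` preserves a cyclic subgroup of order at most four then `x ^ 2` centralizes
it. -/
theorem commute_sq_of_conj_mem_zpowers {h x : G} (h0 : 0 < orderOf h) (h5 : orderOf h < 5)
    (hx : x⁻¹ * h * x ∈ Subgroup.zpowers h) : Commute (x ^ 2) h := by
  classical
  -- The only generators of a cyclic group of order at most four are `h` and `h⁻¹`.
  have key : x⁻¹ * h * x = h ∨ x⁻¹ * h * x = h⁻¹ := by
    have hord : orderOf (x⁻¹ * h * x) = orderOf h := by
      simpa using orderOf_injective (MulAut.conj x⁻¹).toMonoidHom (MulAut.conj x⁻¹).injective h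
    obtain ⟨i, hi, hi'⟩ := (orderOf_pos_iff.1 h0).mem_zpowers_iff_mem_range_orderOf.1 hx |>
        Finset.mem_image.1
    rw [Finset.mem_range] at hi
    rw [← hi'] at hord ⊢
    have hinv : ∀ m, m + 1 = orderOf h → h ^ m = h⁻¹ := fun m hm => by
      rw [eq_inv_iff_mul_eq_one, ← pow_succ, hm, pow_orderOf_eq_one]
    rw [(orderOf_pos_iff.1 h0).orderOf_pow] at hord
    generalize orderOf h = n at *
    interval_cases n <;> interval_cases i <;> simp at hord <;>
      first | exact Or.inl (pow_one h) | exact Or.inr (hinv _ rfl)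
  have h1 : x⁻¹ * (x⁻¹ * h * x) * x = h := by
    rcases key with hk | hk
    · rw [hk, hk]
    · rw [hk]
      have : x⁻¹ * h⁻¹ * x = (x⁻¹ * h * x)⁻¹ := by group
      rw [this, hk, inv_inv]
  calc x ^ 2 * h = x ^ 2 * (x⁻¹ * (x⁻¹ * h * x) * x) := by rw [h1]
    _ = h * x ^ 2 := by rw [pow_two]; group

end TrivialResidue

/-! ### Structure of the torsion subgroup and of `T(p)`. -/

section TorsionSubgroup

variable {G : Type*} [Group G]

/-- Nilpotency makes `γ_j` trivial for large `j`, so the correction factor disappears. -/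
theorem exists_pow_eq_of_hasInfiniteHeight [Group.IsNilpotent G] {p : ℕ} {g : G}
    (hg : HasInfiniteHeight p g) (i : ℕ) : ∃ x : G, x ^ p ^ i = g := by
  obtain ⟨c, hc⟩ :=
    Subgroup.nilpotent_iff_lowerCentralSeries.1 (inferInstance : Group.IsNilpotent G)
  obtain ⟨x, y, hy, h⟩ := hg i c
  rw [hc, Subgroup.mem_bot] at hy
  exact ⟨x, by rw [h, hy, mul_one]⟩

theorem prime_pow_lt_five {p j : ℕ} (hp : p.Prime) (h : p ^ j < 5) :
    j = 0 ∨ p = 2 ∧ j ≤ 2 ∨ p = 3 ∧ j ≤ 1 := by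
  rcases Nat.eq_zero_or_pos j with rfl | hj
  · exact Or.inl rfl
  have hp5 : p < 5 := (Nat.le_self_pow hj.ne' p).trans_lt h
  have := hp.two_le
  interval_cases p
  · exact Or.inr (Or.inl ⟨rfl, Nat.lt_succ_iff.1 ((Nat.pow_lt_pow_iff_right (by norm_num)).1
      (h.trans (by norm_num : 5 < 2 ^ 3)))⟩)
  · exact Or.inr (Or.inr ⟨rfl, Nat.lt_succ_iff.1 ((Nat.pow_lt_pow_iff_right (by norm_num)).1
      (h.trans (by norm_num : 5 < 3 ^ 2)))⟩)
  · exact absurd hp (by norm_num)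

section Divisible

variable {p : ℕ} {g h : G} {k l : ℕ}

theorem orderOf_lt_five_of_divisible_prime (hG : deltaAdicResidue G = ⊥) (hp : p.Prime)
    (hg : g ^ p ^ k = 1) (hdiv : ∀ i, ∃ x : G, x ^ p ^ i = g) : orderOf g < 5 := by
  refine orderOf_lt_five_of_divisible hG (a := p ^ k)
    (fun n => by rw [← pow_mul]; exact hdiv _) hg fun h6 => ?_
  obtain ⟨j, -, hj⟩ := (Nat.dvd_prime_pow hp).1 (orderOf_dvd_of_pow_eq_one hg)
  rw [h6] at hj
  have h2 := Nat.prime_two.dvd_of_dvd_pow (hj ▸ (by norm_num : 2 ∣ 6))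
  have h3 := Nat.prime_three.dvd_of_dvd_pow (hj ▸ (by norm_num : 3 ∣ 6))
  rw [Nat.prime_dvd_prime_iff_eq (by norm_num) hp] at h2 h3
  omega

theorem commute_sq_of_divisible (hG : deltaAdicResidue G = ⊥) (hp : p.Prime) {x : G}
    (hx : x ^ p ^ k = 1) (hh : h ^ p ^ l = 1) (hdiv : ∀ i, ∃ x : G, x ^ p ^ i = h) :
    Commute (x ^ 2) h :=
  commute_sq_of_conj_mem_zpowers
    (Nat.pos_of_dvd_of_pos (orderOf_dvd_of_pow_eq_one hh) (pow_pos hp.pos l))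
    (orderOf_lt_five_of_divisible_prime hG hp hh hdiv)
    (conj_mem_zpowers_of_divisible hG (fun n => by rw [← pow_mul]; exact hdiv _) hx
      (pow_pos hp.pos l) hh)

/-- Elements of `p`-power order that are `pⁱ`-th powers for all `i` commute with each other. -/
theorem commute_of_divisible (hG : deltaAdicResidue G = ⊥) (hp : p.Prime)
    (hg : g ^ p ^ k = 1) (hh : h ^ p ^ l = 1) (hgdiv : ∀ i, ∃ x : G, x ^ p ^ i = g)
    (hhdiv : ∀ i, ∃ x : G, x ^ p ^ i = h) : Commute g h := by
  -- Squares commute with `h`, so it suffices to exhibit `g` as a power of a square: for `p = 2` by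
  -- divisibility, for odd `p` because `g` has odd order.
  rcases hp.eq_two_or_odd' with rfl | hodd
  · obtain ⟨x, hx⟩ := hgdiv 1
    rw [pow_one] at hx
    rw [← hx, ← pow_mul, ← pow_succ'] at hg
    rw [← hx]
    exact commute_sq_of_divisible hG hp hg hh hhdiv
  · obtain ⟨m, hm⟩ := hodd.pow (n := k)
    have : (g ^ 2) ^ (m + 1) = g := by
      rw [← pow_mul, show 2 * (m + 1) = p ^ k + 1 by rw [hm]; ring, pow_succ, hg, one_mul]
    rw [← this]
    exact (commute_sq_of_divisible hG hp hg hh hhdiv).pow_left _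

end Divisible

theorem exists_orderOf_eq_of_dvd {g : G} (hg : IsOfFinOrder g) {q : ℕ}
    (h : q ∣ orderOf g) : ∃ x : G, orderOf x = q :=
  ⟨g ^ (orderOf g / q), orderOf_pow_orderOf_div hg.orderOf_pos.ne' h⟩

/-- Under `𝒱_ω = 1`, if there are elements of orders two and three then the order of every
torsion element divides six. -/
theorem orderOf_dvd_six (hG : deltaAdicResidue G = ⊥) {x y : G} (hx : orderOf x = 2)
    (hy : orderOf y = 3) {t : G} (ht : IsOfFinOrder t) : orderOf t ∣ 6 := by
  rcases eq_or_ne (orderOf t) 1 with h1 | h1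
  · rw [h1]; exact one_dvd _
  have hlt : 1 < orderOf t := lt_of_le_of_ne ht.orderOf_pos h1.symm
  by_cases h2 : (orderOf t).Coprime 2
  · exact Dvd.intro _ (mul_eq_six_of_coprime hG (h := x) (by rwa [hx]) hlt (by omega))
  by_cases h3 : (orderOf t).Coprime 3
  · exact Dvd.intro _ (mul_eq_six_of_coprime hG (h := y) (by rwa [hy]) hlt (by omega))
  have h2' : 2 ∣ orderOf t := by
    rwa [Nat.coprime_comm, Nat.Prime.coprime_iff_not_dvd Nat.prime_two, not_not] at h2
  -- When both 2 and 3 divide the order, the 2-part and the odd part of `t` are themselves a pair of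
  -- nontrivial coprime orders, with product 6.
  obtain ⟨a, b, hb, hab⟩ := Nat.exists_eq_two_pow_mul_odd ht.orderOf_pos.ne'
  have h3' : 3 ∣ orderOf t := by
    rwa [Nat.coprime_comm, Nat.Prime.coprime_iff_not_dvd Nat.prime_three, not_not] at h3
  have hco : (2 ^ a).Coprime b := (Nat.coprime_two_left.2 hb).pow_left a
  have ha0 : 1 < 2 ^ a := by
    refine Nat.one_lt_two_pow fun h0 => ?_
    rw [hab, h0, pow_zero, one_mul] at h2'
    exact Nat.not_even_iff_odd.2 hb (even_iff_two_dvd.2 h2')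
  have hb0 : 3 ∣ b := by
    rw [hab] at h3'
    exact (Nat.prime_three.dvd_mul.1 h3').resolve_left fun h =>
      absurd (Nat.prime_three.dvd_of_dvd_pow h) (by norm_num)
  have hb1 : 1 < b := by
    have := Nat.le_of_dvd hb.pos hb0
    omega
  have e1 : orderOf (t ^ 2 ^ a) = b := by
    rw [ht.orderOf_pow, hab, Nat.gcd_mul_right_left, Nat.mul_div_cancel_left _ (by omega)]
  have e2 : orderOf (t ^ b) = 2 ^ a := by
    rw [ht.orderOf_pow, hab, Nat.gcd_mul_left_left, Nat.mul_div_cancel _ (by omega)]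
  have := mul_eq_six_of_coprime hG (g := t ^ b) (h := t ^ 2 ^ a) (by rwa [e1, e2])
    (by rwa [e2]) (by rwa [e1])
  rw [e1, e2, ← hab] at this
  rw [this]

theorem exists_orderOf_two_three (hG : deltaAdicResidue G = ⊥) {p q : ℕ} (hp : p.Prime)
    (hq : q.Prime) (hpq : p ≠ q) {x y : G} (hx : orderOf x = p) (hy : orderOf y = q) :
    (∃ g : G, orderOf g = 2) ∧ ∃ g : G, orderOf g = 3 := by
  have h6 : p * q = 6 := by
    rw [← hx, ← hy]
    exact mul_eq_six_of_coprime hG (by rw [hx, hy]; exact (Nat.coprime_primes hp hq).2 hpq)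
      (hx ▸ hp.one_lt) (hy ▸ hq.one_lt)
  have hp6 : p ≤ 6 := Nat.le_of_dvd (by norm_num) (Dvd.intro _ h6)
  have hp2 := hp.two_le
  interval_cases p
  · exact ⟨⟨x, hx⟩, ⟨y, by omega⟩⟩
  · exact ⟨⟨y, by omega⟩, ⟨x, hx⟩⟩
  all_goals first | omega | (obtain rfl : q = 1 := by omega); exact absurd hq (by norm_num)

theorem isOfFinOrder_torsionSubgroup [Group.IsNilpotent G] (t : torsionSubgroup G) :
    IsOfFinOrder t := Submonoid.isOfFinOrder_coe.1 t.2

/-- Under `𝒱_ω = 1` the torsion subgroup is a `p`-group or there are elements of orders two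
and three. -/
theorem isPGroup_or_exists_orderOf [Group.IsNilpotent G] (hG : deltaAdicResidue G = ⊥)
    (hT : torsionSubgroup G ≠ ⊥) :
    (∃ p : ℕ, p.Prime ∧ IsPGroup p (torsionSubgroup G)) ∨
      (∃ g : G, orderOf g = 2) ∧ ∃ g : G, orderOf g = 3 := by
  obtain ⟨t, ht1⟩ := Subgroup.ne_bot_iff_exists_ne_one.1 hT
  have hp := Nat.minFac_prime (n := orderOf t) (by rwa [Ne, orderOf_eq_one_iff])
  set p := (orderOf t).minFac with hpdef
  by_cases hP : IsPGroup p (torsionSubgroup G)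
  · exact Or.inl ⟨p, hp, hP⟩
  · refine Or.inr ?_
    rw [IsPGroup] at hP
    push Not at hP
    obtain ⟨s, hs⟩ := hP
    have hs0 := (isOfFinOrder_torsionSubgroup s).orderOf_pos
    obtain ⟨q, hq, hqs, hqp⟩ : ∃ q, q.Prime ∧ q ∣ orderOf s ∧ q ≠ p := by
      by_contra! H
      have := Nat.eq_prime_pow_of_unique_prime_dvd hs0.ne' fun {d} hd hd' => H d hd hd'
      exact hs _ (this ▸ pow_orderOf_eq_one s)
    obtain ⟨x, hx⟩ := exists_orderOf_eq_of_dvd (isOfFinOrder_torsionSubgroup t)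
      (Nat.minFac_dvd _)
    obtain ⟨y, hy⟩ := exists_orderOf_eq_of_dvd (isOfFinOrder_torsionSubgroup s) hqs
    exact exists_orderOf_two_three hG hp hq hqp.symm
      (x := (x : G)) (y := (y : G)) (by rwa [Subgroup.orderOf_coe]) (by rwa [Subgroup.orderOf_coe])

section PGroup

variable [Group.IsNilpotent G] {p : ℕ}

theorem exists_pow_eq_coe {t : torsionSubgroup G} (ht : HasInfiniteHeight p t) (i : ℕ) :
    ∃ x : G, x ^ p ^ i = t :=
  (exists_pow_eq_of_hasInfiniteHeight ht i).imp' _ fun _ hx => by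
    rw [← hx, Subgroup.coe_pow]

theorem exists_orderOf_eq_of_hasInfiniteHeight (hG : deltaAdicResidue G = ⊥) (hp : p.Prime)
    (hP : IsPGroup p (torsionSubgroup G)) {t : torsionSubgroup G} (ht : HasInfiniteHeight p t) :
    ∃ j, orderOf t = p ^ j ∧ (j = 0 ∨ p = 2 ∧ j ≤ 2 ∨ p = 3 ∧ j ≤ 1) := by
  obtain ⟨k, hk⟩ := hP t
  obtain ⟨j, -, hj⟩ := (Nat.dvd_prime_pow hp).1 (orderOf_dvd_of_pow_eq_one hk)
  have := orderOf_lt_five_of_divisible_prime hG hp (g := (t : G)) (k := k)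
    (by rw [← Subgroup.coe_pow, hk, Subgroup.coe_one]) (exists_pow_eq_coe ht)
  rw [Subgroup.orderOf_coe, hj] at this
  exact ⟨j, hj, prime_pow_lt_five hp this⟩

theorem infiniteHeightSubgroup_ne_top (hG : deltaAdicResidue G = ⊥) (hT : torsionSubgroup G ≠ ⊥)
    (hp : p.Prime) (hP : IsPGroup p (torsionSubgroup G)) :
    infiniteHeightSubgroup p (torsionSubgroup G) ≠ ⊤ := by
  intro htop
  have hall : ∀ t : torsionSubgroup G, HasInfiniteHeight p t := fun t => by
    have : t ∈ infiniteHeightSubgroup p (torsionSubgroup G) := htop ▸ Subgroup.mem_top t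
    exact this
  obtain ⟨t, ht1⟩ := Subgroup.ne_bot_iff_exists_ne_one.1 hT
  -- The order of an element of `T(p)` divides `p²`, so if `T(p) = T` every `t = x^(p²)` is trivial.
  obtain ⟨x, hx⟩ := exists_pow_eq_of_hasInfiniteHeight (hall t) 2
  obtain ⟨j, hj, hj'⟩ := exists_orderOf_eq_of_hasInfiniteHeight hG hp hP (hall x)
  refine ht1 (hx ▸ orderOf_dvd_iff_pow_eq_one.1 ?_)
  rw [hj]
  exact pow_dvd_pow p (by omega)

theorem commute_of_hasInfiniteHeight (hG : deltaAdicResidue G = ⊥)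
    (hp : p.Prime) (hP : IsPGroup p (torsionSubgroup G)) {x y : torsionSubgroup G}
    (hx : HasInfiniteHeight p x) (hy : HasInfiniteHeight p y) : x * y = y * x := by
  obtain ⟨k, hk⟩ := hP x
  obtain ⟨l, hl⟩ := hP y
  exact Subtype.ext (commute_of_divisible hG hp (g := (x : G)) (h := (y : G)) (k := k) (l := l)
    (by rw [← Subgroup.coe_pow, hk, Subgroup.coe_one])
    (by rw [← Subgroup.coe_pow, hl, Subgroup.coe_one]) (exists_pow_eq_coe hx)
    (exists_pow_eq_coe hy)).eq

theorem exponent_infiniteHeightSubgroup (hG : deltaAdicResidue G = ⊥)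
    (hp : p.Prime) (hP : IsPGroup p (torsionSubgroup G)) :
    0 < Monoid.exponent (infiniteHeightSubgroup p (torsionSubgroup G)) ∧
      Monoid.exponent (infiniteHeightSubgroup p (torsionSubgroup G)) ≤ 4 := by
  obtain ⟨d, hd0, hd4, hd⟩ : ∃ d, 0 < d ∧ d ≤ 4 ∧
      ∀ x : infiniteHeightSubgroup p (torsionSubgroup G), orderOf (x : torsionSubgroup G) ∣ d := by
    have H := fun x : infiniteHeightSubgroup p (torsionSubgroup G) =>
      exists_orderOf_eq_of_hasInfiniteHeight hG hp hP x.2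
    rcases eq_or_ne p 2 with rfl | h2
    · refine ⟨2 ^ 2, by norm_num, by norm_num, fun x => ?_⟩
      obtain ⟨j, hj, hj'⟩ := H x
      exact hj ▸ pow_dvd_pow _ (by omega)
    rcases eq_or_ne p 3 with rfl | h3
    · refine ⟨3 ^ 1, by norm_num, by norm_num, fun x => ?_⟩
      obtain ⟨j, hj, hj'⟩ := H x
      exact hj ▸ pow_dvd_pow _ (by omega)
    · refine ⟨p ^ 0, by norm_num, by norm_num, fun x => ?_⟩
      obtain ⟨j, hj, hj'⟩ := H x
      exact hj ▸ pow_dvd_pow _ (by omega)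
  have hdvd : Monoid.exponent (infiniteHeightSubgroup p (torsionSubgroup G)) ∣ d :=
    Monoid.exponent_dvd.2 fun x => by rw [← Subgroup.orderOf_coe]; exact hd x
  exact ⟨Nat.pos_of_dvd_of_pos hdvd hd0, (Nat.le_of_dvd hd0 hdvd).trans hd4⟩

end PGroup

theorem exponent_torsionSubgroup_eq_six [Group.IsNilpotent G] (hG : deltaAdicResidue G = ⊥)
    {x y : G} (hx : orderOf x = 2) (hy : orderOf y = 3) :
    Monoid.exponent (torsionSubgroup G) = 6 := by
  have hmem : ∀ {g : G}, 0 < orderOf g → orderOf g ∣ Monoid.exponent (torsionSubgroup G) := by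
    intro g hg
    have := Monoid.order_dvd_exponent (⟨g, orderOf_pos_iff.1 hg⟩ : torsionSubgroup G)
    rwa [← Subgroup.orderOf_coe] at this
  refine Nat.dvd_antisymm (Monoid.exponent_dvd.2 fun t => ?_)
    ((by norm_num : Nat.Coprime 2 3).mul_dvd_of_dvd_of_dvd (hx ▸ hmem (by omega))
      (hy ▸ hmem (by omega)))
  rw [← Subgroup.orderOf_coe]
  exact orderOf_dvd_six hG hx hy t.2

end TorsionSubgroup

end GroupRingUnits

theorem mainTheorem4 {G : Type*} [Group G] [Group.IsNilpotent G]
    (hG : GroupRingUnits.deltaAdicResidue G = ⊥) :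
    (GroupRingUnits.torsionSubgroup G = ⊥ ∨
      ((∀ t : GroupRingUnits.torsionSubgroup G, ∃ a b : ℕ, orderOf t = 2 ^ a * 3 ^ b) ∧
        Monoid.exponent (GroupRingUnits.torsionSubgroup G) = 6) ∨
      ∃ p : ℕ, p.Prime ∧ IsPGroup p (GroupRingUnits.torsionSubgroup G) ∧
        GroupRingUnits.infiniteHeightSubgroup p (GroupRingUnits.torsionSubgroup G) ≠ ⊤ ∧
        IsPGroup p
          (GroupRingUnits.infiniteHeightSubgroup p (GroupRingUnits.torsionSubgroup G)) ∧
        (∀ x ∈ GroupRingUnits.infiniteHeightSubgroup p (GroupRingUnits.torsionSubgroup G),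
          ∀ y ∈ GroupRingUnits.infiniteHeightSubgroup p (GroupRingUnits.torsionSubgroup G),
            x * y = y * x) ∧
        0 < Monoid.exponent
          (GroupRingUnits.infiniteHeightSubgroup p (GroupRingUnits.torsionSubgroup G)) ∧
        Monoid.exponent
          (GroupRingUnits.infiniteHeightSubgroup p (GroupRingUnits.torsionSubgroup G)) ≤ 4) ∧
    ((∀ t ∈ GroupRingUnits.torsionSubgroup G, orderOf t ≠ 2 ∧ orderOf t ≠ 3) →
      (∀ g : G, IsOfFinOrder g → g = 1) ∨
      ∃ p : ℕ, p.Prime ∧ IsPGroup p (GroupRingUnits.torsionSubgroup G) ∧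
        ∀ t : GroupRingUnits.torsionSubgroup G,
          GroupRingUnits.HasInfiniteHeight p t → t = 1) := by
  open GroupRingUnits in
  rcases eq_or_ne (torsionSubgroup G) ⊥ with hT | hT
  · exact ⟨Or.inl hT, fun _ => Or.inl fun g hg =>
      (Subgroup.eq_bot_iff_forall _).1 hT g hg⟩
  rcases isPGroup_or_exists_orderOf hG hT with ⟨p, hp, hP⟩ | ⟨⟨x, hx⟩, y, hy⟩
  · refine ⟨Or.inr (Or.inr ⟨p, hp, hP, infiniteHeightSubgroup_ne_top hG hT hp hP,
      hP.to_subgroup _, fun x hx y hy => commute_of_hasInfiniteHeight hG hp hP hx hy,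
      exponent_infiniteHeightSubgroup hG hp hP⟩), fun h23 => Or.inr ⟨p, hp, hP, fun t ht => ?_⟩⟩
    -- A nontrivial `p`-group has an element of order `p`, so the hypothesis excludes `p = 2` and `p
    -- = 3`, the only primes for which `T(p)` can be nontrivial.
    obtain ⟨s, hs⟩ := Subgroup.ne_bot_iff_exists_ne_one.1 hT
    obtain ⟨k, hk⟩ := hP s
    obtain ⟨i, -, hi⟩ := (Nat.dvd_prime_pow hp).1 (orderOf_dvd_of_pow_eq_one hk)
    have hi0 : i ≠ 0 := fun h => hs (orderOf_eq_one_iff.1 (by rw [hi, h, pow_zero]))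
    obtain ⟨z, hz⟩ := exists_orderOf_eq_of_dvd (isOfFinOrder_torsionSubgroup s)
      (hi ▸ dvd_pow_self p hi0)
    have hp23 := h23 z z.2
    rw [Subgroup.orderOf_coe, hz] at hp23
    obtain ⟨j, hj, hj'⟩ := exists_orderOf_eq_of_hasInfiniteHeight hG hp hP ht
    obtain rfl : j = 0 := by omega
    exact orderOf_eq_one_iff.1 (by rw [hj, pow_zero])
  · refine ⟨Or.inr (Or.inl ⟨fun t => ?_, exponent_torsionSubgroup_eq_six hG hx hy⟩),
      fun h23 => absurd hx (h23 x (orderOf_pos_iff.1 (by omega))).1⟩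
    have h6 := orderOf_dvd_six hG hx hy t.2
    rw [Subgroup.orderOf_coe] at h6
    have hle := Nat.le_of_dvd (by norm_num) h6
    generalize orderOf t = n at *
    interval_cases n
    · norm_num at h6
    · exact ⟨0, 0, rfl⟩
    · exact ⟨1, 0, rfl⟩
    · exact ⟨0, 1, rfl⟩
    · norm_num at h6
    · norm_num at h6
    · exact ⟨1, 1, rfl⟩
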